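/- Let $S = e_1, e_2, \dots$ be a stream of edges of a bipartite graph with sides $L$ and $R$, so $e_i \in L \times R$, and let $t$ be such that $e_1, \dots, e_t$ are pairwise distinct. Let $G^{(t)}$ be the simple bipartite graph with edge set $\{e_1, \dots, e_t\}$. A butterfly in a bipartite graph consists of two distinct vertices $a, b \in L$ and two distinct vertices $x, y \in R$ such that all four edges $(a,x), (a,y), (b,x), (b,y)$ are present. Let $B$ be the number of butterflies in $G^{(t)}$, let $h$ be the maximum number of butterflies in $G^{(t)}$ that a single edge can be part of, and assume $B \ge 1$. Fix $p \in (0, 1]$. Suppose that each arriving edge is put into a reservoir with probability $p$, independently of all the others, and let $Z_p$ be $p^{-4}$ times the number of butterflies formed by the edges in the reservoir after the first $t$ edges have arrived. Then for every $\varepsilon \in (0, 1)$, $$\Pr\bigl[\,|Z_p - B| \ge \varepsilon B\,\bigr] \;\le\; 8h \cdot \exp\left(-\frac{\varepsilon^2 B\, p^4}{12 h}\right).$$ -/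

import Mathlib

/-! A simple bipartite graph with sides `L` and `R` is given by its finite edge set
`E : Finset (L × R)`. -/

/-- The set of butterflies of the bipartite graph with edge set `E`. A butterfly is determined by
its two left vertices `A = {a, b}` and its two right vertices `X = {x, y}`; it is present when all
four edges `(a, x), (a, y), (b, x), (b, y)`, that is `A ×ˢ X`, belong to `E`. -/
def butterflies {L R : Type*} [DecidableEq L] [DecidableEq R] (E : Finset (L × R)) :
    Finset (Finset L × Finset R) :=
  ((E.image Prod.fst).powersetCard 2 ×ˢ (E.image Prod.snd).powersetCard 2).filter
    (fun B => B.1 ×ˢ B.2 ⊆ E)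

/-- The number of butterflies. -/
def butterflyCount {L R : Type*} [DecidableEq L] [DecidableEq R] (E : Finset (L × R)) : ℕ :=
  (butterflies E).card

/-- The number of butterflies of `E` that contain the edge `e`. -/
def edgeButterflyCount {L R : Type*} [DecidableEq L] [DecidableEq R] (E : Finset (L × R))
    (e : L × R) : ℕ :=
  ((butterflies E).filter (fun B => e ∈ B.1 ×ˢ B.2)).card

/-- The maximum number of butterflies of `E` that an edge of `E` can be part of. -/
def maxEdgeButterflyCount {L R : Type*} [DecidableEq L] [DecidableEq R]
    (E : Finset (L × R)) : ℕ :=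
  E.sup (edgeButterflyCount E)

/-- The graph formed by the first `t` edges `stream 0, …, stream (t - 1)` of an edge stream. -/
def streamGraph {L R : Type*} [DecidableEq L] [DecidableEq R] (stream : ℕ → L × R) (t : ℕ) :
    Finset (L × R) :=
  (Finset.range t).image stream

/-- The reservoir of Bernoulli sampling after `t` edges: it is empty at first, and the arriving
edge `stream t` is added exactly when the coin flip `coin t` comes up heads (`true`). -/
def bernReservoir {L R : Type*} [DecidableEq L] [DecidableEq R] (stream : ℕ → L × R)
    (coin : ℕ → Bool) : ℕ → Finset (L × R)
  | 0 => ∅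
  | t + 1 =>
    if coin t = true then insert (stream t) (bernReservoir stream coin t)
    else bernReservoir stream coin t

/-- The estimate returned by Bernoulli sampling with parameter `p` after `t` edges: the number of
butterflies among the sampled edges, multiplied by the normalization factor `p⁻⁴`. -/
noncomputable def bernEstimate {L R : Type*} [DecidableEq L] [DecidableEq R]
    (stream : ℕ → L × R) (p : ℝ) (coin : ℕ → Bool) (t : ℕ) : ℝ :=
  (p ^ 4)⁻¹ * (butterflyCount (bernReservoir stream coin t) : ℝ)

open MeasureTheory ProbabilityTheory

/-! Each butterfly survives sampling with probability `p ^ 4`, so the estimate is unbiased, but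
butterflies sharing an edge survive dependently. A butterfly meets fewer than `4 * h` others
(`card_butterflies_not_disjoint_lt`), so greedy colouring splits them into `4 * h` classes of
edge-disjoint, hence independent, butterflies.

Jensen's inequality across the classes (`mgf_sum_range_le`) bounds the moment generating function of
the total by the class bounds at an argument `4 * h` times larger. Only the sum of the class sizes
enters, so no balanced colouring is needed. The Chernoff exponent is thereby divided by `4 * h`,
whence `3 * 4 * h = 12 * h`, and no union bound over classes is paid. -/

/-- Greedy colouring: if each element of `s` conflicts with fewer than `r` other elements of `s`,
then `s` has a colouring with `r` colours in which no two distinct conflicting elements share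
a colour. -/
theorem exists_coloring_of_card_conflict_lt {ι : Type*} [DecidableEq ι] {r : ℕ}
    (conflict : ι → ι → Prop) [DecidableRel conflict]
    (hsymm : ∀ a b, conflict a b → conflict b a) (s : Finset ι)
    (hdeg : ∀ a ∈ s, ((s.erase a).filter (conflict a)).card < r) :
    ∃ c : ι → ℕ, (∀ a ∈ s, c a < r) ∧
      ∀ a ∈ s, ∀ b ∈ s, a ≠ b → c a = c b → ¬ conflict a b := by
  induction s using Finset.induction_on with
  | empty => exact ⟨fun _ => 0, by simp, by simp⟩
  | insert x s hx ih =>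
    obtain ⟨c, hcr, hc⟩ := ih fun a ha =>
      (Finset.card_le_card (Finset.filter_subset_filter _
        (Finset.erase_subset_erase _ (Finset.subset_insert x s)))).trans_lt
        (hdeg a (Finset.mem_insert_of_mem ha))
    have hlt : ((s.filter (conflict x)).image c).card < (Finset.range r).card := by
      rw [Finset.card_range]
      have h := hdeg x (Finset.mem_insert_self x s)
      rw [Finset.erase_insert hx] at h
      exact Finset.card_image_le.trans_lt h
    obtain ⟨k, hk, hk'⟩ := Finset.exists_mem_notMem_of_card_lt_card hlt
    have hfree : ∀ b ∈ s, k = c b → ¬ conflict x b := fun b hb hkb hconf =>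
      hk' (Finset.mem_image.mpr ⟨b, Finset.mem_filter.mpr ⟨hb, hconf⟩, hkb.symm⟩)
    have hne : ∀ b ∈ s, b ≠ x := fun b hb h => hx (h ▸ hb)
    refine ⟨Function.update c x k, ?_, ?_⟩
    · intro a ha
      rcases Finset.mem_insert.mp ha with rfl | ha
      · simpa using hk
      · simpa [Function.update_of_ne (hne a ha)] using hcr a ha
    · intro a ha b hb hab
      rcases Finset.mem_insert.mp ha with hax | has <;>
        rcases Finset.mem_insert.mp hb with hbx | hbs
      · exact absurd (hax.trans hbx.symm) hab
      · rw [hax, Function.update_self, Function.update_of_ne (hne b hbs)]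
        exact hfree b hbs
      · rw [hbx, Function.update_self, Function.update_of_ne (hne a has)]
        exact fun h hconf => hfree a has h.symm (hsymm _ _ hconf)
      · rw [Function.update_of_ne (hne b hbs), Function.update_of_ne (hne a has)]
        exact hc a has b hbs hab

/-! ### Exponential moments and a Chernoff bound for coloured sums -/

/-- Taylor expansion to second order leaves an error of at most 2/9 |s|³, and 1/2 + 2/9 < 3/4. -/
theorem exp_sub_one_sub_le {s : ℝ} (hs : |s| ≤ 1) : Real.exp s - 1 - s ≤ 3 / 4 * s ^ 2 := by
  have h := (abs_le.mp (Real.exp_bound hs (n := 3) (by norm_num))).2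
  simp only [Finset.sum_range_succ, Finset.sum_range_zero, Nat.factorial] at h
  norm_num at h
  have h3 : |s| ^ 3 ≤ s ^ 2 := by
    rw [← sq_abs s]
    exact pow_le_pow_of_le_one (abs_nonneg s) hs (by norm_num)
  nlinarith [sq_nonneg s]

/-- Jensen's inequality bounds the moment generating function of a sum of `r` dependent variables
by the geometric mean of bounds for the summands at an `r` times larger argument. -/
theorem mgf_sum_range_le {Ω : Type*} [MeasurableSpace Ω] {μ : Measure Ω}
    {r : ℕ} (hr : 0 < r) (X : ℕ → Ω → ℝ) (u : ℝ) (a : ℕ → ℝ)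
    (hint : ∀ j, Integrable (fun ω => Real.exp (r * u * X j ω)) μ)
    (hle : ∀ j, mgf (X j) μ (r * u) ≤ Real.exp (a j)) :
    mgf (fun ω => ∑ j ∈ Finset.range r, X j ω) μ u
      ≤ Real.exp ((∑ j ∈ Finset.range r, a j) / r) := by
  have hr0 : (r : ℝ) ≠ 0 := by positivity
  have hpt : ∀ ω, Real.exp (u * ∑ j ∈ Finset.range r, X j ω) ≤
      Real.exp ((∑ j ∈ Finset.range r, a j) / r) *
        ∑ j ∈ Finset.range r, (r : ℝ)⁻¹ * (Real.exp (-a j) * Real.exp (r * u * X j ω)) := by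
    intro ω
    -- The shift by `-a j` normalises each summand to have integral at most 1; this yields the
    -- geometric mean of the bounds instead of the arithmetic one.
    have hJ := convexOn_exp.map_sum_le (t := Finset.range r) (w := fun _ => (r : ℝ)⁻¹)
      (p := fun j => -a j + r * u * X j ω) (fun _ _ => by positivity)
      (by simp [hr0]) (fun _ _ => Set.mem_univ _)
    simp only [smul_eq_mul, Real.exp_add] at hJ
    refine le_trans (le_of_eq ?_) (mul_le_mul_of_nonneg_left hJ (Real.exp_pos _).le)
    rw [← Real.exp_add]
    congr 1
    rw [← Finset.mul_sum, Finset.sum_add_distrib, Finset.sum_neg_distrib, ← Finset.mul_sum]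
    field_simp
    ring
  have hint' : ∀ j ∈ Finset.range r, Integrable
      (fun ω => (r : ℝ)⁻¹ * (Real.exp (-a j) * Real.exp (r * u * X j ω))) μ :=
    fun j _ => ((hint j).const_mul _).const_mul _
  calc mgf (fun ω => ∑ j ∈ Finset.range r, X j ω) μ u
      ≤ ∫ ω, Real.exp ((∑ j ∈ Finset.range r, a j) / r) *
        ∑ j ∈ Finset.range r, (r : ℝ)⁻¹ * (Real.exp (-a j) * Real.exp (r * u * X j ω)) ∂μ :=
        integral_mono_of_nonneg (Filter.Eventually.of_forall fun _ => (Real.exp_pos _).le)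
          ((integrable_finsetSum _ hint').const_mul _) (Filter.Eventually.of_forall hpt)
    _ = Real.exp ((∑ j ∈ Finset.range r, a j) / r) *
        ∑ j ∈ Finset.range r, (r : ℝ)⁻¹ * (Real.exp (-a j) * mgf (X j) μ (r * u)) := by
        rw [integral_const_mul, integral_finsetSum _ hint']
        simp only [integral_const_mul, mgf]
    _ ≤ Real.exp ((∑ j ∈ Finset.range r, a j) / r) *
        ∑ j ∈ Finset.range r, (r : ℝ)⁻¹ * (Real.exp (-a j) * Real.exp (a j)) := by
        gcongr with j _
        exact hle j
    _ = Real.exp ((∑ j ∈ Finset.range r, a j) / r) := by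
        simp [← Real.exp_add, hr0]

/-- Intersections of independent events over pairwise disjoint blocks are independent. -/
theorem iIndepSet_biInter_of_pairwise_disjoint {Ω ι κ : Type*} [MeasurableSpace Ω] {μ : Measure Ω}
    [DecidableEq κ] {A : κ → Set Ω} (hmeas : ∀ i, MeasurableSet (A i)) (hindep : iIndepSet A μ)
    (T : ι → Finset κ) (hT : Pairwise fun a b => Disjoint (T a) (T b)) :
    iIndepSet (fun b => ⋂ i ∈ T b, A i) μ := by
  rw [iIndepSet_iff_meas_biInter fun b => Finset.measurableSet_biInter _ fun i _ => hmeas i]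
  intro S
  have h := hindep.meas_biInter (S.biUnion T)
  rw [Finset.prod_biUnion fun a _ b _ hab => hT hab, Finset.set_biInter_biUnion] at h
  rw [h]
  exact Finset.prod_congr rfl fun b _ => (hindep.meas_biInter (T b)).symm

/-- The left side equals 1 + μ(A)(eˢ − 1), and 1 + y ≤ eʸ. -/
theorem mgf_indicator_one_le {Ω : Type*} [MeasurableSpace Ω] {μ : Measure Ω}
    [IsProbabilityMeasure μ] {A : Set Ω} (hA : MeasurableSet A) (s : ℝ) :
    mgf (A.indicator fun _ => (1 : ℝ)) μ s ≤ Real.exp (μ.real A * (Real.exp s - 1)) := by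
  have h : ∀ ω, Real.exp (s * A.indicator (fun _ => (1 : ℝ)) ω) =
      1 + A.indicator (fun _ => Real.exp s - 1) ω := by
    intro ω
    by_cases hω : ω ∈ A <;> simp [hω]
  rw [mgf, integral_congr_ae (Filter.Eventually.of_forall h),
    integral_add (integrable_const _) ((integrable_const _).indicator hA),
    integral_indicator_const _ hA]
  simpa [add_comm] using Real.add_one_le_exp (μ.real A * (Real.exp s - 1))

/-- Chernoff's bound for a sum of indicators of probability `q` which is split by the colouring `c`
into `r` classes of independent events. -/
theorem measure_abs_sum_indicator_sub_ge_le {Ω ι : Type*} [MeasurableSpace Ω] {μ : Measure Ω}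
    [IsProbabilityMeasure μ] (s : Finset ι) {r : ℕ} (hr : 0 < r) (c : ι → ℕ)
    (hc : ∀ b ∈ s, c b < r) (A : ι → Set Ω) (hA : ∀ b, MeasurableSet (A b)) (q : ℝ)
    (hq : ∀ b ∈ s, μ.real (A b) = q)
    (hindep : ∀ j, iIndepSet (fun b : {b // b ∈ s ∧ c b = j} => A b) μ)
    {ε : ℝ} (hε0 : 0 ≤ ε) (hε1 : ε ≤ 1) :
    μ.real {ω | ε * (q * s.card) ≤
        |∑ b ∈ s, (A b).indicator (fun _ => (1 : ℝ)) ω - q * s.card|} ≤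
      2 * Real.exp (-(ε ^ 2 * (q * s.card) / (3 * r))) := by
  classical
  have hr0 : (0 : ℝ) < r := by positivity
  -- Only an element of `s` ties `q` to a probability; for empty `s` the bound is the trivial 2.
  rcases s.eq_empty_or_nonempty with rfl | ⟨b₀, hb₀⟩
  · simp only [Finset.card_empty, Nat.cast_zero, mul_zero, zero_div, neg_zero, Real.exp_zero]
    exact measureReal_le_one.trans (by norm_num)
  have hq0 : 0 ≤ q := hq b₀ hb₀ ▸ measureReal_nonneg
  set I : ι → Ω → ℝ := fun b => (A b).indicator fun _ => (1 : ℝ)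
  have hImeas : ∀ b, Measurable (I b) := fun b => measurable_const.indicator (hA b)
  have hInt : ∀ (S : Finset ι) (x : ℝ),
      Integrable (fun ω => Real.exp (x * ∑ b ∈ S, I b ω)) μ := by
    intro S x
    refine Integrable.of_bound (by fun_prop) (Real.exp (|x| * S.card))
      (Filter.Eventually.of_forall fun ω => ?_)
    rw [Real.norm_eq_abs, Real.abs_exp]
    refine Real.exp_le_exp.mpr ?_
    have h0 : ∀ b, 0 ≤ I b ω := fun b => Set.indicator_nonneg (fun _ _ => zero_le_one) ω
    have h1 : ∀ b ∈ S, I b ω ≤ 1 := fun b _ =>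
      Set.indicator_le_self' (fun _ _ => zero_le_one) ω
    have h2 : ∑ b ∈ S, I b ω ≤ S.card := by simpa using Finset.sum_le_sum h1
    exact mul_le_mul (le_abs_self x) h2 (Finset.sum_nonneg fun b _ => h0 b) (abs_nonneg x)
  have hclass : ∀ (j : ℕ) (x : ℝ), mgf (fun ω => ∑ b ∈ s with c b = j, I b ω) μ x ≤
      Real.exp (((s.filter fun b => c b = j).card : ℝ) * (q * (Real.exp x - 1))) := by
    intro j x
    have hfun := (hindep j).iIndepFun_indicator (β := ℝ) (m := inferInstance)
    have heq : (fun ω => ∑ b ∈ s with c b = j, I b ω) =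
        ∑ b ∈ (s.filter fun b => c b = j).subtype (fun b => b ∈ s ∧ c b = j),
          (A b).indicator fun _ => (1 : ℝ) := by
      ext ω
      rw [Finset.sum_apply]
      exact (Finset.sum_subtype_of_mem (fun b => I b ω) (by simp)).symm
    rw [heq, hfun.mgf_sum (fun b => hImeas b)]
    calc _ ≤ ∏ b ∈ (s.filter fun b => c b = j).subtype (fun b => b ∈ s ∧ c b = j),
          Real.exp (q * (Real.exp x - 1)) := by
          refine Finset.prod_le_prod (fun _ _ => mgf_nonneg) fun b _ => ?_
          rw [← hq b b.2.1]
          exact mgf_indicator_one_le (hA b) x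
      _ = _ := by
          rw [Finset.prod_const, ← Real.exp_nat_mul, Finset.card_subtype]
          congr 4
          exact Finset.filter_true_of_mem (by simp)
  have hmgf : ∀ x : ℝ, mgf (fun ω => ∑ b ∈ s, I b ω) μ (x / r) ≤
      Real.exp (q * s.card / r * (Real.exp x - 1)) := by
    intro x
    have hx : (r : ℝ) * (x / r) = x := by field_simp
    have h := mgf_sum_range_le (μ := μ) hr (fun j ω => ∑ b ∈ s with c b = j, I b ω) (x / r)
      (fun j => ((s.filter fun b => c b = j).card : ℝ) * (q * (Real.exp x - 1)))
      (fun j => hInt _ _) (fun j => by rw [hx]; exact hclass j x)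
    have hmaps : ∀ b ∈ s, c b ∈ Finset.range r := fun b hb => Finset.mem_range.mpr (hc b hb)
    simp only [Finset.sum_fiberwise_of_maps_to hmaps] at h
    refine h.trans (le_of_eq ?_)
    rw [← Finset.sum_mul, ← Nat.cast_sum, ← Finset.card_eq_sum_card_fiberwise hmaps]
    congr 1
    ring
  -- Both tails at once, by the sign of `x`. The value 2ε/3 minimises 3/4 x² − εx, with minimum
  -- −ε²/3.
  have key : ∀ x : ℝ, |x| = 2 * ε / 3 →
      Real.exp (-(x / r) * (q * s.card) - |x| / r * ε * (q * s.card)) *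
        mgf (fun ω => ∑ b ∈ s, I b ω) μ (x / r) ≤
      Real.exp (-(ε ^ 2 * (q * s.card) / (3 * r))) := by
    intro x hx
    refine (mul_le_mul_of_nonneg_left (hmgf x) (Real.exp_pos _).le).trans ?_
    rw [← Real.exp_add]
    gcongr
    have h1 := exp_sub_one_sub_le (s := x) (by rw [hx]; linarith)
    rw [← sq_abs, hx] at h1
    have h2 : 0 ≤ q * s.card / r := by positivity
    have h3 := mul_le_mul_of_nonneg_left h1 h2
    rw [hx]
    calc _ = q * s.card / r * (Real.exp x - 1 - x) - q * s.card / r * (2 * ε / 3 * ε) := by ring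
      _ ≤ q * s.card / r * (3 / 4 * (2 * ε / 3) ^ 2) - q * s.card / r * (2 * ε / 3 * ε) := by
        linarith
      _ = _ := by field_simp; ring
  have hup := measure_ge_le_exp_mul_mgf (μ := μ) (X := fun ω => ∑ b ∈ s, I b ω)
    ((1 + ε) * (q * s.card)) (t := 2 * ε / 3 / r) (by positivity) (hInt s _)
  have hlo := measure_le_le_exp_mul_mgf (μ := μ) (X := fun ω => ∑ b ∈ s, I b ω)
    ((1 - ε) * (q * s.card)) (t := -(2 * ε / 3) / r)
    (div_nonpos_of_nonpos_of_nonneg (by linarith) hr0.le) (hInt s _)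
  have habs : |2 * ε / 3| = 2 * ε / 3 := abs_of_nonneg (by positivity)
  have kup := key (2 * ε / 3) habs
  have klo := key (-(2 * ε / 3)) (by rw [abs_neg, habs])
  rw [habs] at kup
  rw [abs_neg, habs] at klo
  have hsub : {ω | ε * (q * s.card) ≤ |∑ b ∈ s, I b ω - q * s.card|} ⊆
      {ω | (1 + ε) * (q * s.card) ≤ ∑ b ∈ s, I b ω} ∪
        {ω | ∑ b ∈ s, I b ω ≤ (1 - ε) * (q * s.card)} := by
    intro ω hω
    rcases le_abs.mp (show ε * (q * s.card) ≤ |∑ b ∈ s, I b ω - q * s.card| from hω) with h | h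
    · exact Or.inl (show (1 + ε) * (q * s.card) ≤ ∑ b ∈ s, I b ω by linarith)
    · exact Or.inr (show ∑ b ∈ s, I b ω ≤ (1 - ε) * (q * s.card) by linarith)
  have e1 : -(2 * ε / 3 / r) * ((1 + ε) * (q * s.card)) =
      -(2 * ε / 3 / r) * (q * s.card) - 2 * ε / 3 / r * ε * (q * s.card) := by ring
  have e2 : -(-(2 * ε / 3) / r) * ((1 - ε) * (q * s.card)) =
      -(-(2 * ε / 3) / r) * (q * s.card) - 2 * ε / 3 / r * ε * (q * s.card) := by ring
  rw [e1] at hup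
  rw [e2] at hlo
  have hU := (measureReal_mono (μ := μ) hsub).trans (measureReal_union_le _ _)
  linarith


/-! ### Butterflies, their overlaps and the reservoir -/

section Butterflies
variable {L R : Type*} [DecidableEq L] [DecidableEq R]

theorem mem_butterflies {E : Finset (L × R)} {b : Finset L × Finset R} :
    b ∈ butterflies E ↔ b.1.card = 2 ∧ b.2.card = 2 ∧ b.1 ×ˢ b.2 ⊆ E := by
  simp only [butterflies, Finset.mem_filter, Finset.mem_product, Finset.mem_powersetCard]
  refine ⟨fun h => ⟨h.1.1.2, h.1.2.2, h.2⟩, fun h => ⟨⟨⟨?_, h.1⟩, ?_, h.2.1⟩, h.2.2⟩⟩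
  · obtain ⟨y, hy⟩ := Finset.card_pos.mp (h.2.1 ▸ two_pos : 0 < b.2.card)
    exact fun x hx =>
      Finset.mem_image.mpr ⟨(x, y), h.2.2 (Finset.mk_mem_product hx hy), rfl⟩
  · obtain ⟨x, hx⟩ := Finset.card_pos.mp (h.1 ▸ two_pos : 0 < b.1.card)
    exact fun y hy =>
      Finset.mem_image.mpr ⟨(x, y), h.2.2 (Finset.mk_mem_product hx hy), rfl⟩

theorem card_product_of_mem_butterflies {E : Finset (L × R)} {b : Finset L × Finset R}
    (hb : b ∈ butterflies E) : (b.1 ×ˢ b.2).card = 4 := by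
  obtain ⟨h1, h2, -⟩ := mem_butterflies.mp hb
  rw [Finset.card_product, h1, h2]

theorem edgeButterflyCount_le_max {E : Finset (L × R)} {e : L × R} (he : e ∈ E) :
    edgeButterflyCount E e ≤ maxEdgeButterflyCount E :=
  Finset.le_sup (f := edgeButterflyCount E) he

/-- A butterfly shares an edge with fewer than `4 h` other butterflies. -/
theorem card_butterflies_not_disjoint_lt {E : Finset (L × R)} {b : Finset L × Finset R}
    (hb : b ∈ butterflies E) :
    (((butterflies E).erase b).filter fun b' => ¬ Disjoint (b.1 ×ˢ b.2) (b'.1 ×ˢ b'.2)).card <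
      4 * maxEdgeButterflyCount E := by
  have hcard := card_product_of_mem_butterflies hb
  obtain ⟨e₀, he₀⟩ : (b.1 ×ˢ b.2).Nonempty := Finset.card_pos.mp (by omega)
  -- The inclusion is strict because `b` itself lies in the union; this saves the one colour that
  -- greedy colouring needs.
  have hsub : ((butterflies E).erase b).filter
        (fun b' => ¬ Disjoint (b.1 ×ˢ b.2) (b'.1 ×ˢ b'.2)) ⊂
      (b.1 ×ˢ b.2).biUnion fun e => (butterflies E).filter fun b' => e ∈ b'.1 ×ˢ b'.2 := by
    refine (Finset.ssubset_iff_of_subset fun b' hb' => ?_).mpr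
      ⟨b, Finset.mem_biUnion.mpr ⟨e₀, he₀, Finset.mem_filter.mpr ⟨hb, he₀⟩⟩, by simp⟩
    obtain ⟨hb'1, hb'2⟩ := Finset.mem_filter.mp hb'
    obtain ⟨e, he, he'⟩ := Finset.not_disjoint_iff.mp hb'2
    exact Finset.mem_biUnion.mpr
      ⟨e, he, Finset.mem_filter.mpr ⟨Finset.mem_of_mem_erase hb'1, he'⟩⟩
  refine (Finset.card_lt_card hsub).trans_le ?_
  rw [← hcard]
  exact Finset.card_biUnion_le_card_mul _ _ _ fun e he =>
    edgeButterflyCount_le_max ((mem_butterflies.mp hb).2.2 he)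

theorem mem_bernReservoir {stream : ℕ → L × R} {coin : ℕ → Bool} {t : ℕ} {e : L × R} :
    e ∈ bernReservoir stream coin t ↔ ∃ i < t, coin i = true ∧ stream i = e := by
  induction t with
  | zero => simp [bernReservoir]
  | succ t ih =>
    simp only [bernReservoir, Nat.exists_lt_succ_right]
    split_ifs with h
    · rw [Finset.mem_insert, ih, or_comm, and_iff_right h, eq_comm (a := e)]
    · rw [ih, or_iff_left fun h' => h h'.1]

/-- The arrival times, among the first `t`, of the edges of `b`. -/
def arrivalTimes (stream : ℕ → L × R) (t : ℕ) (b : Finset L × Finset R) : Finset ℕ :=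
  (Finset.range t).filter fun i => stream i ∈ b.1 ×ˢ b.2

theorem card_arrivalTimes {stream : ℕ → L × R} {t : ℕ} (hstream : Set.InjOn stream (Set.Iio t))
    {b : Finset L × Finset R} (hb : b ∈ butterflies (streamGraph stream t)) :
    (arrivalTimes stream t b).card = 4 := by
  rw [← card_product_of_mem_butterflies hb]
  refine Finset.card_bij (fun i _ => stream i) (fun i hi => (Finset.mem_filter.mp hi).2) ?_ ?_
  · intro i hi j hj hij
    exact hstream (Finset.mem_range.mp (Finset.mem_filter.mp hi).1)
      (Finset.mem_range.mp (Finset.mem_filter.mp hj).1) hij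
  · intro e he
    obtain ⟨i, hi, rfl⟩ := Finset.mem_image.mp ((mem_butterflies.mp hb).2.2 he)
    exact ⟨i, Finset.mem_filter.mpr ⟨hi, he⟩, rfl⟩

theorem disjoint_arrivalTimes (stream : ℕ → L × R) (t : ℕ) {b b' : Finset L × Finset R}
    (h : Disjoint (b.1 ×ˢ b.2) (b'.1 ×ˢ b'.2)) :
    Disjoint (arrivalTimes stream t b) (arrivalTimes stream t b') :=
  Finset.disjoint_left.mpr fun _ hi hi' =>
    Finset.disjoint_left.mp h (Finset.mem_filter.mp hi).2 (Finset.mem_filter.mp hi').2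

/-- Injectivity matters here: a repeated edge could be kept by another coin than the one at a given
arrival time. -/
theorem butterflies_bernReservoir {stream : ℕ → L × R} {t : ℕ}
    (hstream : Set.InjOn stream (Set.Iio t)) (coin : ℕ → Bool) :
    butterflies (bernReservoir stream coin t) = (butterflies (streamGraph stream t)).filter
      fun b => ∀ i ∈ arrivalTimes stream t b, coin i = true := by
  ext b
  rw [Finset.mem_filter, mem_butterflies, mem_butterflies, and_assoc, and_assoc]
  refine and_congr_right fun _ => and_congr_right fun _ => ?_
  simp only [arrivalTimes, Finset.mem_filter]
  refine ⟨fun h => ⟨fun e he => ?_, fun i hi => ?_⟩, fun h e he => ?_⟩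
  · obtain ⟨i, hi, -, rfl⟩ := mem_bernReservoir.mp (h he)
    exact Finset.mem_image_of_mem _ (Finset.mem_range.mpr hi)
  · obtain ⟨j, hj, hc, hij⟩ := mem_bernReservoir.mp (h hi.2)
    rwa [← hstream hj (Finset.mem_range.mp hi.1) hij]
  · obtain ⟨i, hi, rfl⟩ := Finset.mem_image.mp (h.1 he)
    exact mem_bernReservoir.mpr ⟨i, Finset.mem_range.mp hi, h.2 i ⟨hi, he⟩, rfl⟩

theorem butterflyCount_bernReservoir {Ω : Type*} {stream : ℕ → L × R} {t : ℕ}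
    (hstream : Set.InjOn stream (Set.Iio t)) (coin : ℕ → Ω → Bool) (ω : Ω) :
    (butterflyCount (bernReservoir stream (fun i => coin i ω) t) : ℝ) =
      ∑ b ∈ butterflies (streamGraph stream t),
        (⋂ i ∈ arrivalTimes stream t b, {ω | coin i ω = true}).indicator (fun _ => (1 : ℝ)) ω := by
  rw [butterflyCount, butterflies_bernReservoir hstream, Finset.natCast_card_filter]
  refine Finset.sum_congr rfl fun b _ => ?_
  have hmem : (ω ∈ ⋂ i ∈ arrivalTimes stream t b, {ω | coin i ω = true}) ↔
      ∀ i ∈ arrivalTimes stream t b, coin i ω = true := by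
    simp only [Set.mem_iInter, Set.mem_ofPred_eq]
  split_ifs with h
  · rw [Set.indicator_of_mem (hmem.mpr h)]
  · rw [Set.indicator_of_notMem fun h' => h (hmem.mp h')]

end Butterflies

/-! ### The concentration bound -/

theorem mainTheorem3 {L R : Type*} [DecidableEq L] [DecidableEq R]
    {Ω : Type*} [MeasurableSpace Ω] (μ : MeasureTheory.Measure Ω)
    [MeasureTheory.IsProbabilityMeasure μ]
    (stream : ℕ → L × R) (t : ℕ)
    -- the graph is simple: the first `t` edges of the stream are distinct
    (hstream : Set.InjOn stream (Set.Iio t))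
    (p : ℝ) (hp0 : 0 < p) (hp1 : p ≤ 1)
    -- independent coin flips, each showing heads with probability `p`
    (coin : ℕ → Ω → Bool) (hmeas : ∀ i, Measurable (coin i))
    (hindep : ProbabilityTheory.iIndepFun coin μ)
    (hcoin : ∀ i, μ {ω | coin i ω = true} = ENNReal.ofReal p)
    (ε : ℝ) (hε0 : 0 < ε) (hε1 : ε < 1)
    -- there is at least one butterfly
    (hB : 0 < butterflyCount (streamGraph stream t)) :
    μ.real {ω | ε * (butterflyCount (streamGraph stream t) : ℝ) ≤
        |bernEstimate stream p (fun i => coin i ω) t -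
          (butterflyCount (streamGraph stream t) : ℝ)|} ≤
      8 * (maxEdgeButterflyCount (streamGraph stream t) : ℝ) *
        Real.exp (-(ε ^ 2 * (butterflyCount (streamGraph stream t) : ℝ) * p ^ 4 /
          (12 * (maxEdgeButterflyCount (streamGraph stream t) : ℝ)))) := by
  set G := streamGraph stream t
  set h := maxEdgeButterflyCount G
  obtain ⟨b₀, hb₀⟩ := Finset.card_pos.mp hB
  have hh0 : 0 < h := by
    have := card_butterflies_not_disjoint_lt hb₀
    omega
  obtain ⟨c, hcr, hc⟩ := exists_coloring_of_card_conflict_lt (r := 4 * h)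
    (fun b b' : Finset L × Finset R => ¬ Disjoint (b.1 ×ˢ b.2) (b'.1 ×ˢ b'.2))
    (fun _ _ hab hba => hab hba.symm) (butterflies G)
    (fun b hb => card_butterflies_not_disjoint_lt hb)
  have hheads : ∀ i, MeasurableSet {ω | coin i ω = true} := fun i =>
    hmeas i (measurableSet_singleton true)
  have hind : iIndepSet (fun i => {ω | coin i ω = true}) μ := by
    rw [iIndepSet_iff_meas_biInter hheads]
    exact fun S => hindep.measure_inter_preimage_eq_mul S (sets := fun _ => {true})
      fun _ _ => measurableSet_singleton true
  have hprob : ∀ b ∈ butterflies G,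
      μ.real (⋂ i ∈ arrivalTimes stream t b, {ω | coin i ω = true}) = p ^ 4 := by
    intro b hb
    rw [measureReal_def, hind.meas_biInter, Finset.prod_congr rfl fun i _ => hcoin i,
      Finset.prod_const, card_arrivalTimes hstream hb, ENNReal.toReal_pow,
      ENNReal.toReal_ofReal hp0.le]
  have hchern := measure_abs_sum_indicator_sub_ge_le (μ := μ) (butterflies G)
    (by omega : 0 < 4 * h) c hcr
    (fun b => ⋂ i ∈ arrivalTimes stream t b, {ω | coin i ω = true})
    (fun b => Finset.measurableSet_biInter _ fun i _ => hheads i) (p ^ 4) hprob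
    (fun j => iIndepSet_biInter_of_pairwise_disjoint hheads hind
      (fun b : {b // b ∈ butterflies G ∧ c b = j} => arrivalTimes stream t b)
      fun b b' hbb' => disjoint_arrivalTimes stream t
        (not_not.mp (hc b b.2.1 b' b'.2.1 (Subtype.coe_injective.ne hbb')
          (b.2.2.trans b'.2.2.symm)))) hε0.le hε1.le
  have hp4 : 0 < p ^ 4 := by positivity
  -- Multiplying the deviation inequality by `p ^ 4` removes the normalisation of the estimate.
  have hset : {ω | ε * (butterflyCount G : ℝ) ≤
      |bernEstimate stream p (fun i => coin i ω) t - (butterflyCount G : ℝ)|} =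
      {ω | ε * (p ^ 4 * ((butterflies G).card : ℝ)) ≤ |∑ b ∈ butterflies G,
        (⋂ i ∈ arrivalTimes stream t b, {ω | coin i ω = true}).indicator (fun _ => (1 : ℝ)) ω -
          p ^ 4 * ((butterflies G).card : ℝ)|} := by
    ext ω
    simp only [Set.mem_ofPred_eq]
    rw [← butterflyCount_bernReservoir hstream coin ω, bernEstimate, ← butterflyCount,
      ← mul_le_mul_iff_right₀ hp4, ← abs_of_pos hp4, ← abs_mul, abs_of_pos hp4, mul_sub,
      mul_inv_cancel_left₀ hp4.ne', mul_left_comm]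
  rw [hset]
  refine hchern.trans ?_
  have hexp : -(ε ^ 2 * (p ^ 4 * ((butterflies G).card : ℝ)) / (3 * ((4 * h : ℕ) : ℝ))) =
      -(ε ^ 2 * (butterflyCount G : ℝ) * p ^ 4 / (12 * (h : ℝ))) := by
    rw [butterflyCount]
    push_cast
    ring
  rw [hexp]
  -- The prefactor obtained is 2, which is at most `8 * h` since `h ≥ 1`.
  have h1 : (1 : ℝ) ≤ h := by exact_mod_cast hh0
  gcongr
  linarith
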